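/- Let $L_0$ be pure second-order logic (object variables and relation variables of all arities, no constants), and let $L_0[\partial]$ add an operator $\partial$ from concepts (unary relations) to objects. A structure $\mathcal M=(M,S_1[M],S_2[M],\dots,\partial)$ has a non-empty domain $M$, sets $S_k[M]$ of $k$-ary relations on $M$, and a map $\partial:S_1[M]\to M$; it is standard if each $S_k[M]$ contains all $k$-ary relations on $M$. Let $E(X,Y)$ be an $L_0$-formula with only the concept variables $X,Y$ free, which defines an equivalence relation on the concepts of every standard structure. The theory $A_E$ consists of the abstraction principle $(\forall X,Y)(\partial X=\partial Y\leftrightarrow E(X,Y))$ and the axioms of the background logic, namely the comprehension axioms for all $L_0[\partial]$-formulas with parameters and the cardinality principles: any two cardinalities are comparable; $|X\sqcup Y|=|X\times Y|=\max(|X|,|Y|)$ for Dedekind infinite $X,Y$; and whenever some concept satisfies an $L_0$-formula $\Phi(X)$ (parameters allowed), some concept of least cardinality does. Here cardinalities are compared by functions belonging to the structure. "$A_E$ proves $\sigma$" means that $\sigma$ holds in all models of $A_E$, standard or not (equivalently, by completeness, that $\sigma$ is deducible). Write $X\boxminus Y$ if $|X|=|Y|$ and $|M-X|=|M-Y|$.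 The slice $E(\boxminus)_X$ is trivial if $[X]_\boxminus\cap[X]_E=[X]_\boxminus$, i.e. if $E(X,Y)$ for every $Y$ with $X\boxminus Y$. **Corollary.** Suppose that $A_E$ proves $|M|>4$. Then $A_E$ is unsatisfiable (has no standard model) if and only if $A_E$ entails, with respect to standard models, that $E(\boxminus)_X$ is non-trivial for some $X$ with $|X|=|M-X|=|M|$; that is, if and only if every standard model of $A_E$ contains a concept $X$ with $|X|=|M-X|=|M|$ for which $E(\boxminus)_X$ is non-trivial. -/

import Mathlib

universe u

namespace SecondOrder

/-! ### The second-order languages `L₀` and `L₀[∂]`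

Second-order variables have an arity `k + 1`, recorded by the number `k`; so `k = 0` is the sort of
concepts.  Formulas are well scoped: `Formula D n Γ` has (at most) the free object variables
`0, …, n - 1` and free second-order variables of the sorts listed in `Γ`. -/

/-- `RelVar Γ k`: the second-order variables of arity `k + 1` that are in scope in `Γ`. -/
inductive RelVar : List ℕ → ℕ → Type
  | zero {Γ : List ℕ} {k : ℕ} : RelVar (k :: Γ) k
  | succ {Γ : List ℕ} {j k : ℕ} : RelVar Γ k → RelVar (j :: Γ) k

/-- Terms: object variables, and `∂ X` for a concept variable `X` and a symbol `∂` in `D`. -/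
inductive Term (D : Type) (n : ℕ) (Γ : List ℕ) : Type
  | var : Fin n → Term D n Γ
  | app : D → RelVar Γ 0 → Term D n Γ

/-- Second-order formulas whose operators from concepts to objects are named by `D`. -/
inductive Formula (D : Type) : ℕ → List ℕ → Type
  | eq {n : ℕ} {Γ : List ℕ} : Term D n Γ → Term D n Γ → Formula D n Γ
  | atom {n : ℕ} {Γ : List ℕ} {k : ℕ} :
      RelVar Γ k → (Fin (k + 1) → Term D n Γ) → Formula D n Γ
  | neg {n : ℕ} {Γ : List ℕ} : Formula D n Γ → Formula D n Γ
  | and {n : ℕ} {Γ : List ℕ} : Formula D n Γ → Formula D n Γ → Formula D n Γ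
  | allObj {n : ℕ} {Γ : List ℕ} : Formula D (n + 1) Γ → Formula D n Γ
  | allRel {n : ℕ} {Γ : List ℕ} (k : ℕ) : Formula D n (k :: Γ) → Formula D n Γ

/-- `L₀`, the purely logical language: no constants and no operators. -/
abbrev L₀ : ℕ → List ℕ → Type := Formula Empty

/-- `L₀[∂]`: the language `L₀` together with one operator `∂` from concepts to objects. -/
abbrev L₀abs : ℕ → List ℕ → Type := Formula Unit

namespace Formula

variable {D : Type} {n : ℕ} {Γ : List ℕ}

/-- `(∃ x) φ`. -/
def exObj (φ : Formula D (n + 1) Γ) : Formula D n Γ := neg (allObj (neg φ))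

/-- `x ≠ y` for object variables. -/
def ne (i j : Fin n) : Formula D n Γ := neg (eq (.var i) (.var j))

/-- The sentence `|M| > 4`: there are five pairwise distinct objects. -/
def moreThanFour : Formula D 0 [] :=
  exObj <| exObj <| exObj <| exObj <| exObj <|
    (ne 0 1).and <| (ne 0 2).and <| (ne 0 3).and <| (ne 0 4).and <|
    (ne 1 2).and <| (ne 1 3).and <| (ne 1 4).and <|
    (ne 2 3).and <| (ne 2 4).and <| ne 3 4

end Formula

/-! ### Structures -/

/-- An `L₀`-structure `(M, S₁[M], S₂[M], …)` in the general (non-standard) semantics: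
a non-empty domain `M = Obj`, and for each `k` a set `Rel k = S_{k+1}[M]` of `(k + 1)`-ary
relations on `M`. -/
structure Frame : Type (u + 1) where
  Obj : Type u
  nonempty : Nonempty Obj
  Rel : (k : ℕ) → Set (Set (Fin (k + 1) → Obj))

namespace Frame

variable (F : Frame.{u})

/-- A structure is standard if its second-order variables range over all relations. -/
def IsStandard : Prop := ∀ k : ℕ, F.Rel k = Set.univ

/-- The concepts of the structure: the members of `S₁[M]`. -/
def Concept : Type u := {X : Set (Fin 1 → F.Obj) // X ∈ F.Rel 0}

variable {F} in
/-- The set of objects that fall under a concept. -/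
def Concept.ext (X : F.Concept) : Set F.Obj := {x | (fun _ => x) ∈ X.1}

/-- Values of the second-order variables in scope. -/
def Env (Γ : List ℕ) : Type u := (k : ℕ) → RelVar Γ k → {R : Set (Fin (k + 1) → F.Obj) // R ∈ F.Rel k}

variable {F} in
/-- Give the value `R` to a newly bound second-order variable. -/
def Env.cons {Γ : List ℕ} {k : ℕ} (R : {R : Set (Fin (k + 1) → F.Obj) // R ∈ F.Rel k})
    (V : F.Env Γ) : F.Env (k :: Γ)
  | _, .zero => R
  | _, .succ x => V _ x

/-- The empty assignment. -/
def Env.nil : F.Env [] := fun _ x => nomatch x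

/-- Value of a term; `δ` interprets the operators in `D`. -/
def val {D : Type} (δ : D → F.Concept → F.Obj) {n : ℕ} {Γ : List ℕ}
    (v : Fin n → F.Obj) (V : F.Env Γ) : Term D n Γ → F.Obj
  | .var i => v i
  | .app d X => δ d (V 0 X)

/-- Satisfaction in the general semantics. -/
def Sat {D : Type} (δ : D → F.Concept → F.Obj) :
    {n : ℕ} → {Γ : List ℕ} → Formula D n Γ → (Fin n → F.Obj) → F.Env Γ → Prop
  | _, _, .eq s t, v, V => F.val δ v V s = F.val δ v V t
  | _, _, .atom R t, v, V => (fun i => F.val δ v V (t i)) ∈ (V _ R).1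
  | _, _, .neg φ, v, V => ¬ Sat δ φ v V
  | _, _, .and φ ψ, v, V => Sat δ φ v V ∧ Sat δ ψ v V
  | _, _, .allObj φ, v, V => ∀ x : F.Obj, Sat δ φ (Fin.cons x v) V
  | _, _, .allRel k φ, v, V =>
      ∀ R : {R : Set (Fin (k + 1) → F.Obj) // R ∈ F.Rel k}, Sat δ φ v (Env.cons R V)

/-- Satisfaction of `L₀`-formulas. -/
def Sat₀ {n : ℕ} {Γ : List ℕ} (φ : L₀ n Γ) (v : Fin n → F.Obj) (V : F.Env Γ) : Prop :=
  F.Sat (fun d => nomatch d) φ v V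

/-- The relation between concepts that an `L₀`-formula `E(X, Y)`, with only the concept
variables `X` and `Y` free, defines (without parameters) in the structure. -/
def Holds (E : L₀ 0 [0, 0]) (X Y : F.Concept) : Prop :=
  F.Sat₀ E Fin.elim0 (Env.cons X (Env.cons Y (Env.nil F)))

/-! ### Cardinality inside a structure -/

variable {F} in
/-- `R` restricts to an injective function from `A` into `B`. -/
def IsInj (R : Set (Fin 2 → F.Obj)) (A B : Set F.Obj) : Prop :=
  (∀ x ∈ A, ∃ y ∈ B, ∀ y', ![x, y'] ∈ R ↔ y' = y) ∧
    ∀ x ∈ A, ∀ x' ∈ A, ∀ y, ![x, y] ∈ R → ![x', y] ∈ R → x = x'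

/-- `|A| ≤ |B|` in the structure. -/
def CardLE (A B : Set F.Obj) : Prop := ∃ R ∈ F.Rel 1, IsInj R A B

/-- `|A| = |B|` in the structure: it contains a bijection from `A` onto `B`. -/
def CardEq (A B : Set F.Obj) : Prop :=
  ∃ R ∈ F.Rel 1, IsInj R A B ∧ ∀ y ∈ B, ∃ x ∈ A, ![x, y] ∈ R

/-- `|X| ≥ ω` in the structure: it contains an injection from `X` into a proper subconcept. -/
def Infinite (X : F.Concept) : Prop := ∃ Y : F.Concept, Y.ext ⊂ X.ext ∧ F.CardLE X.ext Y.ext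

/-- `|A ⊔ B| = |C|` in the structure: it contains injections of `A` and of `B` into `C` whose
ranges partition `C`. -/
def SumCardEq (A B C : Set F.Obj) : Prop :=
  ∃ R ∈ F.Rel 1, ∃ T ∈ F.Rel 1, IsInj R A C ∧ IsInj T B C ∧
    (∀ x ∈ A, ∀ x' ∈ B, ∀ y, ¬ (![x, y] ∈ R ∧ ![x', y] ∈ T)) ∧
    ∀ y ∈ C, (∃ x ∈ A, ![x, y] ∈ R) ∨ ∃ x ∈ B, ![x, y] ∈ T

/-- `|A × B| = |C|` in the structure: it contains a bijection from `A × B` onto `C`. -/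
def ProdCardEq (A B C : Set F.Obj) : Prop :=
  ∃ R ∈ F.Rel 2,
    (∀ x ∈ A, ∀ y ∈ B, ∃ z ∈ C, ∀ z', ![x, y, z'] ∈ R ↔ z' = z) ∧
    (∀ x ∈ A, ∀ y ∈ B, ∀ x' ∈ A, ∀ y' ∈ B, ∀ z,
      ![x, y, z] ∈ R → ![x', y', z] ∈ R → x = x' ∧ y = y') ∧
    ∀ z ∈ C, ∃ x ∈ A, ∃ y ∈ B, ![x, y, z] ∈ R

/-- Cardinal comparability. -/
def CardinalComparability : Prop :=
  ∀ X Y : F.Concept, F.CardLE X.ext Y.ext ∨ F.CardLE Y.ext X.ext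

/-- `|X ⊔ Y| = max (|X|, |Y|)` for infinite `X`, `Y`. -/
def InfiniteSumsAreMaxima : Prop :=
  ∀ X Y : F.Concept, F.Infinite X → F.Infinite Y →
    (F.CardLE Y.ext X.ext → F.SumCardEq X.ext Y.ext X.ext) ∧
    (F.CardLE X.ext Y.ext → F.SumCardEq X.ext Y.ext Y.ext)

/-- `|X × Y| = max (|X|, |Y|)` for infinite `X`, `Y`. -/
def InfiniteProductsAreMaxima : Prop :=
  ∀ X Y : F.Concept, F.Infinite X → F.Infinite Y →
    (F.CardLE Y.ext X.ext → F.ProdCardEq X.ext Y.ext X.ext) ∧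
    (F.CardLE X.ext Y.ext → F.ProdCardEq X.ext Y.ext Y.ext)

/-- Cardinality is well-founded: for every `L₀`-formula `Φ(X)` (with parameters), if some concept
satisfies `Φ` then one of least cardinality does. -/
def CardinalityWellFounded : Prop :=
  ∀ (n : ℕ) (Γ : List ℕ) (Φ : L₀ n (0 :: Γ)) (v : Fin n → F.Obj) (V : F.Env Γ),
    (∃ X : F.Concept, F.Sat₀ Φ v (Env.cons X V)) →
      ∃ X : F.Concept, F.Sat₀ Φ v (Env.cons X V) ∧
        ∀ Y : F.Concept, F.Sat₀ Φ v (Env.cons Y V) → F.CardLE X.ext Y.ext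

/-! ### Bicardinal slices -/

/-- `X ⊟ Y`: bicardinal equivalence. -/
def Bicard (X Y : F.Concept) : Prop := F.CardEq X.ext Y.ext ∧ F.CardEq X.extᶜ Y.extᶜ

/-- `[X]_⊟`. -/
def bicardClass (X : F.Concept) : Set F.Concept := {Y | F.Bicard X Y}

/-- `[X]_{E(⊟)} = [X]_⊟ ∩ [X]_E`. -/
def sliceClass (E : L₀ 0 [0, 0]) (X : F.Concept) : Set F.Concept :=
  F.bicardClass X ∩ {Y | F.Holds E X Y}

/-- The bicardinal slice `E(⊟)_X` is trivial. -/
def SliceTrivial (E : L₀ 0 [0, 0]) (X : F.Concept) : Prop :=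
  F.sliceClass E X = F.bicardClass X

end Frame

/-! ### The theory `A_E` -/

/-- An `L₀[∂]`-structure: an `L₀`-structure with an operator `∂` from its concepts to objects. -/
structure AbsStructure : Type (u + 1) extends Frame.{u} where
  abs : toFrame.Concept → Obj

namespace AbsStructure

variable (S : AbsStructure.{u})

/-- Satisfaction of `L₀[∂]`-formulas. -/
def Sat {n : ℕ} {Γ : List ℕ} (φ : L₀abs n Γ) (v : Fin n → S.Obj) (V : S.toFrame.Env Γ) : Prop :=
  S.toFrame.Sat (fun _ => S.abs) φ v V

/-- The comprehension axioms for all formulas of `L₀[∂]`, with object and relation parameters. -/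
def Comprehension : Prop :=
  ∀ (k n : ℕ) (Γ : List ℕ) (φ : L₀abs ((k + 1) + n) Γ) (v : Fin n → S.Obj)
    (V : S.toFrame.Env Γ),
    {x : Fin (k + 1) → S.Obj | S.Sat φ (Fin.append x v) V} ∈ S.Rel k

/-- The abstraction principle `A_E[∂]`: for all concepts `X`, `Y`, `∂X = ∂Y` iff `E(X, Y)`. -/
def Abstraction (E : L₀ 0 [0, 0]) : Prop :=
  ∀ X Y : S.toFrame.Concept, S.abs X = S.abs Y ↔ S.toFrame.Holds E X Y

/-- `S` is a model of the theory `A_E`, whose axioms are the abstraction principle for `E`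
and those of the background logic: comprehension and the cardinality principles. -/
structure ModelsTheory (E : L₀ 0 [0, 0]) : Prop where
  comprehension : S.Comprehension
  comparability : S.toFrame.CardinalComparability
  sums : S.toFrame.InfiniteSumsAreMaxima
  products : S.toFrame.InfiniteProductsAreMaxima
  wellFounded : S.toFrame.CardinalityWellFounded
  abstraction : S.Abstraction E

end AbsStructure

/-- The theory `A_E` proves the sentence `σ`.  Deductive consequence in second-order logic is, by
completeness, consequence in the general semantics: `σ` holds in all models of `A_E`, standard
or not. -/
def Proves (E : L₀ 0 [0, 0]) (σ : L₀abs 0 []) : Prop :=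
  ∀ S : AbsStructure.{u}, S.ModelsTheory E → S.Sat σ Fin.elim0 (Frame.Env.nil S.toFrame)

/-- The theory `A_E` is satisfiable: it has a standard model. -/
def Satisfiable (E : L₀ 0 [0, 0]) : Prop :=
  ∃ S : AbsStructure.{u}, S.toFrame.IsStandard ∧ S.ModelsTheory E

end SecondOrder

/-!
The right-hand side can hold only vacuously: in a standard model `M` of `A_E`, every slice
`E(⊟)_X` with `|X| = |M - X| = |M|` is trivial (`sliceTrivial_of_half`), so a standard model never
contains the concept that the right-hand side asks for.

Call a subset of `M` with `|X| = |M - X| = |M|` a moiety, and call two sets *independent* if each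
of the four cells into which they divide `M` has `|M|` elements. A moiety exists only if `M` is
infinite. The relation `E` is defined by a purely logical formula, so it is invariant under the
permutations of `M` (`sat_map_iff`), and any two pairs of independent sets are conjugate under a
permutation (`IndependentSets.exists_perm`). So, as soon as *one* independent pair is `E`-related,
all are; and then any two moieties are `E`-related, since some set is independent of both
(`exists_independentSets_pair`).

An `E`-related independent pair comes from Cantor's theorem: there are `2^|M|` sets any two of
which are independent (`exists_independent_family`), and the operator `∂`, which maps sets to
elements of `M`, must agree on two of them, whence these are `E`-related by the abstraction
principle.
-/

namespace SecondOrder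

open Cardinal

/-! ### Independent pairs of sets -/

/-- `A` and `B` are independent if each of the four cells `A ∩ B`, `A \ B`, `B \ A`, `(A ∪ B)ᶜ` has
the cardinality of the whole type. The cells are indexed by the pairs of truth values of
membership, so that they are the fibres of `x ↦ (x ∈ A, x ∈ B)`. -/
def IndependentSets {α : Type u} (A B : Set α) : Prop :=
  ∀ c : Prop × Prop, #α ≤ #{x // (x ∈ A, x ∈ B) = c}

variable {α : Type u}

theorem IndependentSets.exists_perm {A B A' B' : Set α} (h : IndependentSets A B)
    (h' : IndependentSets A' B') :
    ∃ σ : Equiv.Perm α, σ ⁻¹' A' = A ∧ σ ⁻¹' B' = B := by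
  have e (c : Prop × Prop) :
      Nonempty ({x // (x ∈ A, x ∈ B) = c} ≃ {x // (x ∈ A', x ∈ B') = c}) :=
    Cardinal.eq.1 (((mk_subtype_le _).antisymm (h c)).trans ((h' c).antisymm (mk_subtype_le _)))
  let σ : Equiv.Perm α := Equiv.ofFiberEquiv fun c => (e c).some
  have hσ (x : α) : (σ x ∈ A', σ x ∈ B') = (x ∈ A, x ∈ B) :=
    Equiv.ofFiberEquiv_map (g := fun x => (x ∈ A', x ∈ B')) (fun c => (e c).some) x
  exact ⟨σ, Set.ext fun x => iff_of_eq (congrArg Prod.fst (hσ x)),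
    Set.ext fun x => iff_of_eq (congrArg Prod.snd (hσ x))⟩

theorem exists_independent_family [Infinite α] :
    ∃ Z : (α → Prop) → Set α, ∀ f g, f ≠ g → IndependentSets (Z f) (Z g) := by
  -- Cut `α` into `|α|` blocks of the form `α × (Prop × Prop)`; in the block `i`, the set `Z f` is
  -- given by the first or by the second truth value, according to `f i`.
  have hα : ℵ₀ ≤ #α := aleph0_le_mk α
  have hcard : #α = #(α × α × Prop × Prop) := by
    have h1 : #(α × Prop × Prop) = #α := by
      rw [mk_prod, lift_id'.{0, u}]
      exact mul_eq_left hα ((lift_lt_aleph0.2 (lt_aleph0_of_finite (Prop × Prop))).le.trans hα)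
        (by simp)
    rw [mk_prod, h1, lift_id, mul_eq_self hα]
  obtain ⟨e⟩ := Cardinal.eq.1 hcard
  refine ⟨fun f => {x | (f (e x).1 ∧ (e x).2.2.1) ∨ (¬ f (e x).1 ∧ (e x).2.2.2)}, ?_⟩
  intro f g hfg c
  obtain ⟨i, hi⟩ := Function.ne_iff.1 hfg
  by_cases hf : f i
  · have hg : ¬ g i := fun hg => hi (propext (iff_of_true hf hg))
    exact mk_le_of_injective (f := fun j => ⟨e.symm (i, j, c.1, c.2), by simp [hf, hg]⟩)
      fun j j' h => by simpa using h
  · have hg : g i := by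
      by_contra hg
      exact hi (propext (iff_of_false hf hg))
    exact mk_le_of_injective (f := fun j => ⟨e.symm (i, j, c.2, c.1), by simp [hf, hg]⟩)
      fun j j' h => by simpa using h

/-- An infinite set is cut by some `Z` into two parts of its own cardinality. -/
theorem exists_halving (T : Set α) [Infinite T] :
    ∃ Z : Set α, ∀ b : Prop, #T ≤ #{x // x ∈ T ∧ (x ∈ Z) = b} := by
  have hcard : #T = #(T × Prop) := by
    rw [mk_prod, lift_id'.{0, u}]
    exact (mul_eq_left (aleph0_le_mk T)
      ((lift_lt_aleph0.2 (lt_aleph0_of_finite Prop)).le.trans (aleph0_le_mk T)) (by simp)).symm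
  obtain ⟨e⟩ := Cardinal.eq.1 hcard
  refine ⟨{x | ∃ h : x ∈ T, (e ⟨x, h⟩).2}, fun b => ?_⟩
  refine mk_le_of_injective (f := fun t => ⟨(e.symm (t, b) : T), (e.symm (t, b)).2, ?_⟩) ?_
  · simp
  · intro t t' h
    simpa [Subtype.ext_iff] using Subtype.ext (Subtype.mk.inj h)

/-- `X` is a moiety: `X` and its complement both have the cardinality of the whole type. They are
indexed by the truth value of membership in `X`. -/
def IsMoiety (X : Set α) : Prop := ∀ a : Prop, #α ≤ #{x // (x ∈ X) = a}

theorem exists_independentSets_pair [Infinite α] {X Y : Set α} (hX : IsMoiety X)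
    (hY : IsMoiety Y) : ∃ Z, IndependentSets X Z ∧ IndependentSets Y Z := by
  let cell (c : Prop × Prop) : Set α := {x | (x ∈ X, x ∈ Y) = c}
  -- `Z` halves each of the large cells of `X` and `Y`.
  have hcell (c : Prop × Prop) : ∃ Z : Set α, #α ≤ #(cell c) →
      ∀ b : Prop, #α ≤ #{x // x ∈ cell c ∧ (x ∈ Z) = b} := by
    by_cases h : #α ≤ #(cell c)
    · have : Infinite (cell c) := infinite_iff.2 ((aleph0_le_mk α).trans h)
      obtain ⟨Z, hZ⟩ := exists_halving (cell c)
      exact ⟨Z, fun _ b => h.trans (hZ b)⟩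
    · exact ⟨∅, fun h' => absurd h' h⟩
  choose W hW using hcell
  let Z : Set α := {x | x ∈ W (x ∈ X, x ∈ Y)}
  have hZ (c : Prop × Prop) (h : #α ≤ #(cell c)) (b : Prop) :
      #α ≤ #{x // x ∈ cell c ∧ (x ∈ Z) = b} := by
    refine (hW c h b).trans (mk_le_of_injective (f := Subtype.map id ?_)
      (Subtype.map_injective _ Function.injective_id))
    rintro x ⟨rfl, hx⟩
    exact ⟨rfl, hx⟩
  -- A set of size `|α|` that two sets cover has a piece of size `|α|`.
  have large {S A B : Set α} (hS : #α ≤ #S) (h : S ⊆ A ∪ B) : #α ≤ #A ∨ #α ≤ #B := by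
    by_contra! hlt
    exact (hS.trans ((mk_le_mk_of_subset h).trans (mk_union_le A B))).not_gt
      (add_lt_of_lt (aleph0_le_mk α) hlt.1 hlt.2)
  refine ⟨Z, fun ⟨a, b⟩ => ?_, fun ⟨a, b⟩ => ?_⟩
  · obtain ⟨q, hq⟩ : ∃ q, #α ≤ #(cell (a, q)) := by
      rcases large (A := cell (a, True)) (B := cell (a, False)) (hX a) (fun x hx => by
        by_cases hy : x ∈ Y
        · exact Or.inl (Prod.ext hx (eq_true hy))
        · exact Or.inr (Prod.ext hx (eq_false hy))) with h | h
      exacts [⟨_, h⟩, ⟨_, h⟩]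
    exact (hZ _ hq b).trans (mk_le_of_injective (f := Subtype.map id fun x hx =>
      Prod.ext (Prod.mk.inj hx.1).1 hx.2) (Subtype.map_injective _ Function.injective_id))
  · obtain ⟨p, hp⟩ : ∃ p, #α ≤ #(cell (p, a)) := by
      rcases large (A := cell (True, a)) (B := cell (False, a)) (hY a) (fun x hx => by
        by_cases hy : x ∈ X
        · exact Or.inl (Prod.ext (eq_true hy) hx)
        · exact Or.inr (Prod.ext (eq_false hy) hx)) with h | h
      exacts [⟨_, h⟩, ⟨_, h⟩]
    exact (hZ _ hp b).trans (mk_le_of_injective (f := Subtype.map id fun x hx =>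
      Prod.ext (Prod.mk.inj hx.1).2 hx.2) (Subtype.map_injective _ Function.injective_id))

/-! ### Permutation invariance of logical formulas in standard structures -/

namespace Frame

variable {F : Frame.{u}}

/-- The relation into which a permutation of the domain of a standard structure carries `R`. -/
def mapRel (hF : F.IsStandard) (σ : Equiv.Perm F.Obj) {k : ℕ}
    (R : {R : Set (Fin (k + 1) → F.Obj) // R ∈ F.Rel k}) :
    {R : Set (Fin (k + 1) → F.Obj) // R ∈ F.Rel k} :=
  ⟨{r | (fun i => σ.symm (r i)) ∈ R.1}, Set.eq_univ_iff_forall.1 (hF k) _⟩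

theorem mapRel_surjective (hF : F.IsStandard) (σ : Equiv.Perm F.Obj) (k : ℕ) :
    Function.Surjective (mapRel hF σ (k := k)) := fun R =>
  ⟨mapRel hF σ.symm R, Subtype.ext (Set.ext fun r => by simp [mapRel])⟩

/-- The assignment into which a permutation of the domain carries the assignment `V`. -/
def Env.map (hF : F.IsStandard) (σ : Equiv.Perm F.Obj) {Γ : List ℕ} (V : F.Env Γ) : F.Env Γ :=
  fun k x => mapRel hF σ (V k x)

theorem Env.map_cons (hF : F.IsStandard) (σ : Equiv.Perm F.Obj) {Γ : List ℕ} {k : ℕ}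
    (R : {R : Set (Fin (k + 1) → F.Obj) // R ∈ F.Rel k}) (V : F.Env Γ) :
    (Env.cons R V).map hF σ = Env.cons (mapRel hF σ R) (V.map hF σ) := by
  funext j x
  cases x <;> rfl

theorem Env.map_nil (hF : F.IsStandard) (σ : Equiv.Perm F.Obj) :
    (Env.nil F).map hF σ = Env.nil F := by
  funext j x
  cases x

theorem val_map (hF : F.IsStandard) (σ : Equiv.Perm F.Obj) (δ : Empty → F.Concept → F.Obj)
    {n : ℕ} {Γ : List ℕ} (v : Fin n → F.Obj) (V : F.Env Γ) (t : Term Empty n Γ) :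
    F.val δ (σ ∘ v) (V.map hF σ) t = σ (F.val δ v V t) := by
  cases t with
  | var i => rfl
  | app d _ => exact d.elim

/-- Satisfaction of purely logical formulas in a standard structure is invariant under
permutations of the domain. -/
theorem sat_map_iff (hF : F.IsStandard) (σ : Equiv.Perm F.Obj) (δ : Empty → F.Concept → F.Obj)
    {n : ℕ} {Γ : List ℕ} (φ : L₀ n Γ) (v : Fin n → F.Obj) (V : F.Env Γ) :
    F.Sat δ φ (σ ∘ v) (V.map hF σ) ↔ F.Sat δ φ v V := by
  induction φ with
  | eq s t => simp [Sat, val_map]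
  | atom R t => simp [Sat, val_map, Env.map, mapRel]
  | neg φ ih => simp only [Sat, ih]
  | and φ ψ ihφ ihψ => simp only [Sat, ihφ, ihψ]
  | allObj φ ih =>
    refine σ.surjective.forall.trans (forall_congr' fun x => ?_)
    rw [← ih (Fin.cons x v) V, Fin.comp_cons]
  | allRel k φ ih =>
    refine (mapRel_surjective hF σ k).forall.trans (forall_congr' fun R => ?_)
    rw [← ih v (Env.cons R V), Env.map_cons]

/-- The concept into which a permutation of the domain of a standard structure carries `X`. -/
def mapConcept (hF : F.IsStandard) (σ : Equiv.Perm F.Obj) (X : F.Concept) : F.Concept :=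
  mapRel (k := 0) hF σ X

theorem holds_mapConcept_iff (hF : F.IsStandard) (σ : Equiv.Perm F.Obj) (E : L₀ 0 [0, 0])
    (X Y : F.Concept) :
    F.Holds E (mapConcept hF σ X) (mapConcept hF σ Y) ↔ F.Holds E X Y := by
  have he : (Env.cons (k := 0) X (Env.cons (k := 0) Y (Env.nil F))).map hF σ =
      Env.cons (mapConcept hF σ X) (Env.cons (mapConcept hF σ Y) (Env.nil F)) :=
    (Env.map_cons hF σ _ _).trans
      (congrArg _ ((Env.map_cons hF σ _ _).trans (congrArg _ (Env.map_nil hF σ))))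
  have h := sat_map_iff hF σ (fun d => nomatch d) E Fin.elim0
    (Env.cons (k := 0) X (Env.cons (k := 0) Y (Env.nil F)))
  rwa [he, Subsingleton.elim (σ ∘ Fin.elim0) Fin.elim0] at h

/-! ### Concepts of a standard structure and their cardinalities -/

theorem Concept.ext_injective : Function.Injective (Concept.ext (F := F)) := by
  intro X Y h
  refine Subtype.ext (Set.ext fun r => ?_)
  rw [show r = fun _ => r 0 from funext fun i => congrArg r (Subsingleton.elim i 0)]
  exact Set.ext_iff.1 h (r 0)

/-- The concept with a given extension, in a standard structure. -/
def conceptOf (hF : F.IsStandard) (A : Set F.Obj) : F.Concept :=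
  ⟨{r | r 0 ∈ A}, Set.eq_univ_iff_forall.1 (hF 0) _⟩

theorem ext_conceptOf (hF : F.IsStandard) (A : Set F.Obj) : (conceptOf hF A).ext = A := rfl

theorem ext_mapConcept (hF : F.IsStandard) (σ : Equiv.Perm F.Obj) (X : F.Concept) :
    (mapConcept hF σ X).ext = σ.symm ⁻¹' X.ext := rfl

theorem CardEq.mk_eq {A B : Set F.Obj} (h : F.CardEq A B) : #A = #B := by
  obtain ⟨R, -, ⟨hfun, hinj⟩, hsurj⟩ := h
  choose f hf using hfun
  refine Cardinal.eq.2 ⟨Equiv.ofBijective (fun x : A => ⟨f x x.2, (hf x x.2).1⟩) ⟨?_, ?_⟩⟩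
  · intro x x' hxx'
    exact Subtype.ext (hinj x x.2 x' x'.2 (f x x.2) (((hf x x.2).2 _).2 rfl)
      (((hf x' x'.2).2 _).2 (Subtype.mk.inj hxx')))
  · rintro ⟨y, hy⟩
    obtain ⟨x, hx, hxy⟩ := hsurj y hy
    exact ⟨⟨x, hx⟩, Subtype.ext (((hf x hx).2 y).1 hxy).symm⟩

end Frame

theorem isMoiety_of_mk_eq {X : Set α} (h : #X = #α) (h' : #(Xᶜ : Set α) = #α) : IsMoiety X := by
  intro a
  by_cases ha : a
  · exact h.ge.trans (mk_le_of_injective (f := Subtype.map id fun x hx =>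
      propext (iff_of_true hx ha)) (Subtype.map_injective _ Function.injective_id))
  · exact h'.ge.trans (mk_le_of_injective (f := Subtype.map id fun x hx =>
      propext (iff_of_false hx ha)) (Subtype.map_injective _ Function.injective_id))

theorem infinite_of_mk_eq [Nonempty α] {X : Set α} (h : #X = #α) (h' : #(Xᶜ : Set α) = #α) :
    Infinite α := by
  by_contra hfin
  have : Finite α := not_infinite_iff_finite.1 hfin
  have hsum := mk_sum_compl X
  rw [h, h'] at hsum
  have hlt : #α < ℵ₀ := lt_aleph0_of_finite α
  obtain ⟨n, hn⟩ := lt_aleph0.1 hlt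
  have hpos : #α ≠ 0 := mk_ne_zero α
  rw [hn] at hsum hpos
  norm_cast at hsum hpos
  omega

/-! ### Slices of moieties in standard models -/

/-- In a standard model any two moieties fall under the same abstract. -/
theorem holds_of_isMoiety {E : L₀ 0 [0, 0]} {S : AbsStructure.{u}} (hS : S.toFrame.IsStandard)
    (hE : S.Abstraction E) [Infinite S.Obj] {X Y : S.toFrame.Concept} (hX : IsMoiety X.ext)
    (hY : IsMoiety Y.ext) : S.toFrame.Holds E X Y := by
  obtain ⟨Z, hZ⟩ := exists_independent_family (α := S.Obj)
  obtain ⟨f, g, hfg, hne⟩ : ∃ f g, S.abs (Frame.conceptOf hS (Z f)) =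
      S.abs (Frame.conceptOf hS (Z g)) ∧ f ≠ g := by
    by_contra! hinj
    exact Function.cantor_injective (fun A : Set S.Obj => S.abs (Frame.conceptOf hS (Z (· ∈ A))))
      fun A B hAB => Set.ext fun x => iff_of_eq (congrFun (hinj _ _ hAB) x)
  have key (A B : S.toFrame.Concept) (hAB : IndependentSets A.ext B.ext) : S.abs A = S.abs B := by
    obtain ⟨σ, hA, hB⟩ := hAB.exists_perm (hZ f g hne)
    rw [hE, ← Frame.holds_mapConcept_iff hS σ, ← hE]
    have hmap (C : S.toFrame.Concept) (T : Set S.Obj) (hC : σ ⁻¹' T = C.ext) :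
        Frame.mapConcept hS σ C = Frame.conceptOf hS T := by
      apply Frame.Concept.ext_injective
      rw [Frame.ext_mapConcept, ← hC, Frame.ext_conceptOf, ← Set.preimage_comp]
      simp
    rw [hmap A _ hA, hmap B _ hB, hfg]
  obtain ⟨W, hXW, hYW⟩ := exists_independentSets_pair hX hY
  exact (hE X Y).1 ((key X (Frame.conceptOf hS W) hXW).trans
    (key Y (Frame.conceptOf hS W) hYW).symm)

theorem sliceTrivial_of_half {E : L₀ 0 [0, 0]} {S : AbsStructure.{u}}
    (hS : S.toFrame.IsStandard) (hE : S.Abstraction E) (X : S.toFrame.Concept)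
    (h : S.toFrame.CardEq X.ext X.extᶜ) (h' : S.toFrame.CardEq X.extᶜ Set.univ) :
    S.toFrame.SliceTrivial E X := by
  have hXc : #(X.extᶜ : Set S.Obj) = #S.Obj := h'.mk_eq.trans mk_univ
  have hX : #X.ext = #S.Obj := h.mk_eq.trans hXc
  have : Nonempty S.Obj := S.nonempty
  have : Infinite S.Obj := infinite_of_mk_eq hX hXc
  refine Set.inter_eq_left.2 fun Y hXY => ?_
  exact holds_of_isMoiety hS hE (isMoiety_of_mk_eq hX hXc)
    (isMoiety_of_mk_eq (hXY.1.mk_eq.symm.trans hX) (hXY.2.mk_eq.symm.trans hXc))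

end SecondOrder

theorem mainTheorem9 (E : SecondOrder.L₀ 0 [0, 0])
    (hE : ∀ F : SecondOrder.Frame.{u}, F.IsStandard → Equivalence (F.Holds E))
    (h4 : SecondOrder.Proves.{u} E SecondOrder.Formula.moreThanFour) :
    ¬ SecondOrder.Satisfiable.{u} E ↔
      ∀ S : SecondOrder.AbsStructure.{u}, S.toFrame.IsStandard → S.ModelsTheory E →
        ∃ X : S.toFrame.Concept,
          S.toFrame.CardEq X.ext X.extᶜ ∧ S.toFrame.CardEq X.extᶜ Set.univ ∧
            ¬ S.toFrame.SliceTrivial E X := by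
  constructor
  · exact fun h S hS hM => absurd ⟨S, hS, hM⟩ h
  · rintro h ⟨S, hS, hM⟩
    obtain ⟨X, hX, hXc, hnt⟩ := h S hS hM
    exact hnt (SecondOrder.sliceTrivial_of_half hS hM.abstraction X hX hXc)
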